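/- Conventions. A \emph{discrete measured groupoid} is a groupoid $\mathcal G$ (composition $gh$ defined when $\mathrm d(g)=\mathrm r(h)$) with unit space $X=\mathcal G^{(0)}$, such that $\mathcal G$ is a standard Borel space with Borel structure maps and countable fibres $\mathrm d^{-1}(x)$, together with a probability measure $\mu$ on $X$ which is invariant, i.e. $\int_X \#(\mathrm d^{-1}(x)\cap A)\,d\mu(x)=\int_X \#(\mathrm r^{-1}(x)\cap A)\,d\mu(x)$ for all Borel $A\subset\mathcal G$. The \emph{full group} $[\mathcal G]$ consists of the Borel sets $\sigma\subset\mathcal G$ (modulo null sets) containing, for every $x\in X$, exactly one arrow with domain $x$ and exactly one arrow with range $x$; the latter is denoted $x\sigma$. Let $\pi$ be a unitary or orthogonal representation of $\mathcal G$ on a measurable Hilbert bundle $(\mathcal H_x)_{x\in X}$ (with a fundamental sequence of sections $\xi^n$ that is total in each fibre and has measurable functions $x\mapsto\langle\xi^n_x,\xi^m_x\rangle$): unitary maps $\pi(g):\mathcal H_{\mathrm d(g)}\to\mathcal H_{\mathrm r(g)}$ with $\pi(gh)=\pi(g)\pi(h)$ for almost all composable $(g,h)$ and with $g\mapsto\langle\pi(g)\xi_{\mathrm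 d(g)},\eta_{\mathrm r(g)}\rangle$ measurable for all measurable sections $\xi,\eta$. A \emph{1-cocycle} for $\pi$ is a measurable map $g\mapsto b(g)\in\mathcal H_{\mathrm r(g)}$ with $b(gh)=b(g)+\pi(g)b(h)$ for all composable $(g,h)$. It is \emph{bounded} if there are measurable sets $E_n\subset X$, $n\ge1$, with $\mu(\bigcup_nE_n)=1$ and $\sup\{\|b(g)\| : \mathrm d(g),\mathrm r(g)\in E_n\}<\infty$ for each $n$; \emph{unbounded} if it is not bounded; and \emph{strongly unbounded} if there is $\delta>0$ such that for all $R>0$ there is $\sigma\in[\mathcal G]$ with $\mu(\{x\in X:\|b(x\sigma)\|\ge R\})>\delta$. A \emph{group bundle} is a groupoid with $\mathrm d=\mathrm r$. A \emph{semidirect product groupoid} is a discrete measured groupoid that is isomorphic, up to null sets, to $\Gamma\rtimes_\delta\mathcal R$, where $\mathcal R$ is a Borel equivalence relation with countable classes on a standard probability space $Y$, $\Gamma=(G_y)_{y\in Y}$ is a Borel bundle of countable groups, and $\delta_{(y,x)}:G_x\to G_y$, $(y,x)\in\mathcal R$, is a Borel family of group isomorphisms with $\delta_{(z,y)}\delta_{(y,x)}=\delta_{(z,x)}$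 and $\delta_{(x,x)}=\mathrm{id}$; its elements are the pairs $((y,x),g)$ with $(y,x)\in\mathcal R$, $g\in G_x$, with $((z,y),h)((y,x),g)=((z,x),\delta_{(x,y)}(h)g)$. The equivalence relation $\mathcal R_{\mathcal G}=\{(\mathrm r(g),\mathrm d(g)):g\in\mathcal G\}$ on $(X,\mu)$ is \emph{treeable} if there is a Borel graph $T\subset\mathcal R_{\mathcal G}$ on $X$ such that for $\mu$-almost every $x$ the connected component of $x$ in $T$ is a tree whose vertex set is the $\mathcal R_{\mathcal G}$-class of $x$. Proposition. Let $b$ be a 1-cocycle for a representation $\pi$ of a discrete measured groupoid $\mathcal G$. (1) If $b$ is strongly unbounded, then $b$ is unbounded. (2) If $\mathcal G$ is a semidirect product groupoid, then $b$ is unbounded if and only if it is strongly unbounded. (3) In particular, the same equivalence holds if $\mathcal G$ is a group bundle, and (4) it holds if the equivalence relation $\mathcal R_{\mathcal G}$ is treeable. -/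

import Mathlib

open CategoryTheory MeasureTheory
open scoped ENNReal

universe u v w

namespace MeasuredGroupoid

/-! ### Discrete measured groupoids

A groupoid with unit space `X` is Mathlib's `CategoryTheory.Groupoid X`: an arrow `g : x ⟶ y`
has domain `x` and range `y`, and the product of `g : y ⟶ z` and `h : x ⟶ y`, written `g h` on
paper, is `h ≫ g`. -/

section Groupoid

/-- The set of all arrows of a groupoid with unit space `X`. -/
@[ext] structure Arr (X : Type u) [Groupoid.{v} X] where
  {dom : X}
  {cod : X}
  hom : dom ⟶ cod

/-- Pairs of composable arrows. -/
structure ComposablePair (X : Type u) [Groupoid.{v} X] where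
  {src : X}
  {mid : X}
  {tgt : X}
  fst : src ⟶ mid
  snd : mid ⟶ tgt

/-- The set of composable pairs carries the Borel structure of a subset of the product. -/
instance ComposablePair.instMeasurableSpace (X : Type u) [Groupoid.{v} X]
    [MeasurableSpace (Arr X)] : MeasurableSpace (ComposablePair X) :=
  MeasurableSpace.comap (fun p => ((⟨p.fst⟩ : Arr X), (⟨p.snd⟩ : Arr X))) inferInstance

/-- A discrete measurable (Borel) groupoid: the unit space and the set of arrows are standard Borel
spaces, all structure maps are Borel, and every domain fibre is countable. -/
class DiscreteBorelGroupoid (X : Type u) [Groupoid.{v} X] [MeasurableSpace X]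
    [MeasurableSpace (Arr X)] : Prop where
  standardBorel_units : StandardBorelSpace X
  standardBorel_arrows : StandardBorelSpace (Arr X)
  measurable_dom : Measurable (fun g : Arr X => g.dom)
  measurable_cod : Measurable (fun g : Arr X => g.cod)
  measurable_unit : Measurable (fun x : X => (⟨𝟙 x⟩ : Arr X))
  measurable_inv : Measurable (fun g : Arr X => (⟨Groupoid.inv g.hom⟩ : Arr X))
  measurable_comp : Measurable (fun p : ComposablePair X => (⟨p.fst ≫ p.snd⟩ : Arr X))
  countable_fibre : ∀ x : X, {g : Arr X | g.dom = x}.Countable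

variable {X : Type u} [Groupoid.{v} X] [MeasurableSpace X] [MeasurableSpace (Arr X)]

/-- The measure `μ_d (A) = ∫ #(d⁻¹(x) ∩ A) dμ(x)` of a Borel set `A` of arrows. -/
noncomputable def domMass (μ : Measure X) (A : Set (Arr X)) : ℝ≥0∞ :=
  ∫⁻ x, (({g : Arr X | g.dom = x} ∩ A).encard : ℝ≥0∞) ∂μ

/-- The measure `μ_r (A) = ∫ #(r⁻¹(x) ∩ A) dμ(x)` of a Borel set `A` of arrows. -/
noncomputable def codMass (μ : Measure X) (A : Set (Arr X)) : ℝ≥0∞ :=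
  ∫⁻ x, (({g : Arr X | g.cod = x} ∩ A).encard : ℝ≥0∞) ∂μ

/-- `μ` is invariant if `μ_d = μ_r` on Borel sets of arrows. -/
def IsInvariant (μ : Measure X) : Prop :=
  ∀ A : Set (Arr X), MeasurableSet A → domMass μ A = codMass μ A

/-- `(X, μ)` with its arrows is a discrete measured groupoid. -/
structure IsDiscreteMeasuredGroupoid (μ : Measure X) : Prop where
  borel : DiscreteBorelGroupoid X
  prob : IsProbabilityMeasure μ
  invariant : IsInvariant μ

/-- A Borel bisection: a Borel set of arrows which contains at most one arrow with any given domain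
and at most one arrow with any given range. -/
def IsBisection (σ : Set (Arr X)) : Prop :=
  MeasurableSet σ ∧ ∀ x : X, (σ ∩ {g | g.dom = x}).Subsingleton ∧
    (σ ∩ {g | g.cod = x}).Subsingleton

/-- `σ` represents an element of the full group: it is a Borel bisection with `σ⁻¹ σ = X` (every
point is the domain of an arrow in `σ`) and `σ σ⁻¹ = X` (every point is the range of one).
Every class of such bisections modulo null sets has a representative of this kind. -/
def IsFullGroupElement (σ : Set (Arr X)) : Prop :=
  IsBisection σ ∧ (∀ x : X, ∃ g ∈ σ, g.dom = x) ∧ (∀ x : X, ∃ g ∈ σ, g.cod = x)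

end Groupoid

/-! ### Representations on measurable Hilbert bundles and 1-cocycles -/

section Representation

/-- A measurable Hilbert bundle structure on a family of Hilbert spaces over `X`: a fundamental
sequence of sections, total in every fibre, with Borel inner products. -/
structure HilbertBundle (𝕜 : Type*) [RCLike 𝕜] {X : Type u} [MeasurableSpace X] (H : X → Type w)
    [∀ x, NormedAddCommGroup (H x)] [∀ x, InnerProductSpace 𝕜 (H x)] where
  frame : ℕ → ∀ x, H x
  total : ∀ x, closure (Submodule.span 𝕜 (Set.range fun n => frame n x) : Set (H x)) = Set.univ
  measurable_inner : ∀ m n, Measurable fun x => inner 𝕜 (frame m x) (frame n x)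

variable {𝕜 : Type*} [RCLike 𝕜] {X : Type u} [MeasurableSpace X] {H : X → Type w}
  [∀ x, NormedAddCommGroup (H x)] [∀ x, InnerProductSpace 𝕜 (H x)]

/-- Given a measurable map `p : α → X`, a map `a ↦ v a ∈ H (p a)` into the bundle is measurable iff
all its coordinates against the fundamental sequence are. -/
def HilbertBundle.IsMeasurableOver (B : HilbertBundle 𝕜 H) {α : Type*} [MeasurableSpace α]
    (p : α → X) (v : ∀ a, H (p a)) : Prop :=
  ∀ n, Measurable fun a => inner 𝕜 (B.frame n (p a)) (v a)

/-- Measurable sections of the bundle. -/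
def HilbertBundle.IsMeasurableSection (B : HilbertBundle 𝕜 H) (ξ : ∀ x, H x) : Prop :=
  B.IsMeasurableOver (fun x : X => x) ξ

/-- A unitary (`𝕜 = ℂ`) or orthogonal (`𝕜 = ℝ`) representation on the bundle. It is multiplicative
on almost all composable pairs: as domain fibres are countable, a property holds for almost all
`(g, h)` iff for almost every `x` it holds for all composable `(g, h)` such that `h` has
domain `x`. -/
structure Representation [Groupoid.{v} X] [MeasurableSpace (Arr X)] (μ : Measure X)
    (B : HilbertBundle 𝕜 H) where
  toFun : ∀ {x y : X}, (x ⟶ y) → (H x ≃ₗᵢ[𝕜] H y)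
  map_comp : ∀ᵐ x ∂μ, ∀ (y z : X) (h : x ⟶ y) (g : y ⟶ z) (v : H x),
    toFun (h ≫ g) v = toFun g (toFun h v)
  measurable_coeff : ∀ ξ η : ∀ x, H x, B.IsMeasurableSection ξ → B.IsMeasurableSection η →
    Measurable fun g : Arr X => inner 𝕜 (η g.cod) (toFun g.hom (ξ g.dom))

variable [Groupoid.{v} X] [MeasurableSpace (Arr X)] {μ : Measure X} {B : HilbertBundle 𝕜 H}

/-- A 1-cocycle for `π`: a measurable map `g ↦ b(g) ∈ H_{r(g)}` with
`b(g h) = b(g) + π(g) b(h)` for all composable `(g, h)`. -/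
structure Cocycle (π : Representation μ B) where
  toFun : ∀ {x y : X}, (x ⟶ y) → H y
  measurable : B.IsMeasurableOver (fun g : Arr X => g.cod) (fun g => toFun g.hom)
  cocycle : ∀ {x y z : X} (h : x ⟶ y) (g : y ⟶ z),
    toFun (h ≫ g) = toFun g + π.toFun g (toFun h)

variable {π : Representation μ B}

/-- `b` is bounded if `X` is exhausted, up to a null set, by a sequence of measurable sets `E n`
such that `b` is bounded on all arrows with domain and range in `E n`. -/
def Cocycle.IsBounded (b : Cocycle π) : Prop :=
  ∃ E : ℕ → Set X, (∀ n, MeasurableSet (E n)) ∧ μ (⋃ n, E n) = 1 ∧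
    ∀ n, BddAbove {t : ℝ | ∃ g : Arr X, g.dom ∈ E n ∧ g.cod ∈ E n ∧ t = ‖b.toFun g.hom‖}

/-- `b` is unbounded if it is not bounded. -/
def Cocycle.IsUnbounded (b : Cocycle π) : Prop := ¬ b.IsBounded

/-- `b` is strongly unbounded if there is `δ > 0` such that for all `R > 0` there is `σ` in the full
group with `μ {x | ‖b(xσ)‖ ≥ R} > δ`, where `xσ` is the arrow in `σ` with range `x`. -/
def Cocycle.IsStronglyUnbounded (b : Cocycle π) : Prop :=
  ∃ δ : ℝ, 0 < δ ∧ ∀ R : ℝ, 0 < R → ∃ σ : Set (Arr X), IsFullGroupElement σ ∧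
    ENNReal.ofReal δ < μ {x : X | ∃ g ∈ σ, g.cod = x ∧ R ≤ ‖b.toFun g.hom‖}

end Representation

/-! ### Group bundles, semidirect product groupoids, treeability -/

section Classes

/-- The groupoid is a group bundle: domain and range of every arrow coincide. -/
def IsGroupBundle (X : Type u) [Groupoid.{v} X] : Prop :=
  ∀ g : Arr X, g.dom = g.cod

/-- The total space of a family of groups. -/
structure Tot {Y : Type u} (K : Y → Type v) where
  {base : Y}
  val : K base

/-- Pairs of elements in the same fibre of a family of groups. -/
structure FibrePair {Y : Type u} (K : Y → Type v) where
  {base : Y}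
  fst : K base
  snd : K base

instance FibrePair.instMeasurableSpace {Y : Type u} (K : Y → Type v) [MeasurableSpace (Tot K)] :
    MeasurableSpace (FibrePair K) :=
  MeasurableSpace.comap (fun p => ((⟨p.fst⟩ : Tot K), (⟨p.snd⟩ : Tot K))) inferInstance

/-- A Borel bundle of countable discrete groups over the standard Borel space `Y`. -/
class BorelGroupBundle {Y : Type u} [MeasurableSpace Y] (K : Y → Type v) [∀ y, Group (K y)]
    [MeasurableSpace (Tot K)] : Prop where
  standardBorel_base : StandardBorelSpace Y
  standardBorel_total : StandardBorelSpace (Tot K)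
  countable_fibre : ∀ y, Countable (K y)
  measurable_base : Measurable (fun g : Tot K => g.base)
  measurable_one : Measurable (fun y : Y => (⟨(1 : K y)⟩ : Tot K))
  measurable_inv : Measurable (fun g : Tot K => (⟨g.val⁻¹⟩ : Tot K))
  measurable_mul : Measurable (fun p : FibrePair K => (⟨p.fst * p.snd⟩ : Tot K))

/-- The set `{((y, x), g) | (y, x) ∈ R, g ∈ K x}`. -/
structure RelBundle {Y : Type u} (R : Setoid Y) (K : Y → Type v) where
  {src : Y}
  {tgt : Y}
  rel : R tgt src
  val : K src

instance RelBundle.instMeasurableSpace {Y : Type u} [MeasurableSpace Y] (R : Setoid Y)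
    (K : Y → Type v) [MeasurableSpace (Tot K)] : MeasurableSpace (RelBundle R K) :=
  MeasurableSpace.comap (fun a => ((a.tgt, a.src), (⟨a.val⟩ : Tot K))) inferInstance

/-- A discrete Borel equivalence relation `R` on `Y` with a Borel action on the group bundle `K`;
`act h : K x ≃* K y` for `h : (y, x) ∈ R`. -/
structure BundleAction {Y : Type u} [MeasurableSpace Y] (K : Y → Type v) [∀ y, Group (K y)]
    [MeasurableSpace (Tot K)] where
  R : Setoid Y
  measurableSet_rel : MeasurableSet {p : Y × Y | R p.1 p.2}
  countable_class : ∀ x, {y | R y x}.Countable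
  act : ∀ {y x : Y}, R y x → (K x ≃* K y)
  act_refl : ∀ (x : Y) (g : K x), act (R.refl x) g = g
  act_act : ∀ {z y x : Y} (h : R z y) (h' : R y x) (g : K x),
    act h (act h' g) = act (R.trans h h') g
  measurable_act : Measurable (fun a : RelBundle R K => (⟨act a.rel a.val⟩ : Tot K))

/-- The unit space of the semidirect product groupoid, a copy of `Y`. -/
structure SemidirectUnits {Y : Type u} [MeasurableSpace Y] {K : Y → Type v} [∀ y, Group (K y)]
    [MeasurableSpace (Tot K)] (A : BundleAction K) where
  pt : Y

variable {Y : Type u} [MeasurableSpace Y] {K : Y → Type v} [∀ y, Group (K y)]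
  [MeasurableSpace (Tot K)]

/-- An arrow from `x` to `y` in the semidirect product: `((y, x), g)` with `(y, x) ∈ R` and
`g ∈ K x`. -/
@[ext] structure SemidirectHom (A : BundleAction K) (x y : SemidirectUnits A) where
  rel : A.R y.pt x.pt
  val : K x.pt

/-- The semidirect product groupoid, with `((z, y), h) ((y, x), g) = ((z, x), δ_{(x, y)}(h) g)`
and `((y, x), g)⁻¹ = ((x, y), δ_{(y, x)}(g⁻¹))`. -/
instance SemidirectUnits.instGroupoid (A : BundleAction K) :
    Groupoid.{v} (SemidirectUnits A) where
  Hom x y := SemidirectHom A x y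
  id x := ⟨A.R.refl x.pt, 1⟩
  comp g h := ⟨A.R.trans h.rel g.rel, A.act (A.R.symm g.rel) h.val * g.val⟩
  inv g := ⟨A.R.symm g.rel, A.act g.rel g.val⁻¹⟩
  id_comp g := by
    apply SemidirectHom.ext
    change A.act _ g.val * 1 = g.val
    rw [mul_one]
    exact A.act_refl _ _
  comp_id g := by
    apply SemidirectHom.ext
    change A.act _ 1 * g.val = g.val
    rw [map_one, one_mul]
  assoc f g h := by
    apply SemidirectHom.ext
    change A.act _ h.val * (A.act _ g.val * f.val) = A.act _ (A.act _ h.val * g.val) * f.val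
    rw [map_mul, A.act_act, mul_assoc]
  inv_comp g := by
    apply SemidirectHom.ext
    change A.act _ g.val * A.act g.rel g.val⁻¹ = 1
    rw [← map_mul, mul_inv_cancel, map_one]
  comp_inv g := by
    apply SemidirectHom.ext
    change A.act _ (A.act g.rel g.val⁻¹) * g.val = 1
    rw [A.act_act, A.act_refl, inv_mul_cancel]

instance SemidirectUnits.instMeasurableSpace (A : BundleAction K) :
    MeasurableSpace (SemidirectUnits A) :=
  MeasurableSpace.comap SemidirectUnits.pt inferInstance

/-- The Borel structure inherited from `R × Γ`. -/
instance SemidirectUnits.instMeasurableSpaceArr (A : BundleAction K) :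
    MeasurableSpace (Arr (SemidirectUnits A)) :=
  MeasurableSpace.comap
    (fun g => (⟨g.hom.rel, g.hom.val⟩ : RelBundle A.R K)) inferInstance

/-- The arrows of the restriction of a groupoid to a set `E` of units. -/
abbrev RestrictedArr {X : Type*} [Groupoid X] (E : Set X) : Type _ :=
  {g : Arr X // g.dom ∈ E ∧ g.cod ∈ E}

/-- An isomorphism of discrete measured groupoids, defined up to null sets: a measure preserving
Borel isomorphism between conull Borel sets of units, covered by an isomorphism of groupoids between
the restrictions that is Borel in both directions. -/
structure MeasuredIso {X Z : Type*} [Groupoid X] [MeasurableSpace X] [MeasurableSpace (Arr X)]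
    [Groupoid Z] [MeasurableSpace Z] [MeasurableSpace (Arr Z)] (μ : Measure X) (ν : Measure Z) where
  E : Set X
  F : Set Z
  measurableSet_E : MeasurableSet E
  measurableSet_F : MeasurableSet F
  conull_E : μ Eᶜ = 0
  conull_F : ν Fᶜ = 0
  units : E ≃ᵐ F
  measurePreserving : MeasurePreserving units (μ.comap Subtype.val) (ν.comap Subtype.val)
  arrows : ∀ {x y : E}, ((x : X) ⟶ (y : X)) ≃ ((units x : Z) ⟶ (units y : Z))
  map_comp : ∀ {x y z : E} (f : (x : X) ⟶ (y : X)) (g : (y : X) ⟶ (z : X)),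
    arrows (f ≫ g) = arrows f ≫ arrows g
  measurable_arrows : Measurable fun g : RestrictedArr E =>
    (⟨arrows (x := ⟨g.1.dom, g.2.1⟩) (y := ⟨g.1.cod, g.2.2⟩) g.1.hom⟩ : Arr Z)
  measurable_arrows_symm : ∀ S : Set (RestrictedArr E), MeasurableSet S →
    MeasurableSet ((fun g : RestrictedArr E =>
      (⟨arrows (x := ⟨g.1.dom, g.2.1⟩) (y := ⟨g.1.cod, g.2.2⟩) g.1.hom⟩ : Arr Z)) '' S)

/-- The discrete measured groupoid over `(X, μ)` is (isomorphic to) a semidirect product groupoid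
`Γ ⋊ R` of a discrete Borel equivalence relation on a standard probability space acting on a bundle
of countable groups. -/
def IsSemidirectProduct {X : Type u} [Groupoid.{v} X] [MeasurableSpace X] [MeasurableSpace (Arr X)]
    (μ : Measure X) : Prop :=
  ∃ (Y : Type u) (_ : MeasurableSpace Y) (K : Y → Type v) (_ : ∀ y, Group (K y))
    (_ : MeasurableSpace (Tot K)) (_ : BorelGroupBundle K) (A : BundleAction K)
    (ν : Measure (SemidirectUnits A)) (_ : IsProbabilityMeasure ν), Nonempty (MeasuredIso μ ν)

/-- The equivalence relation `{(r(g), d(g))}` of a groupoid on its unit space. -/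
def orbitRel (X : Type u) [Groupoid.{v} X] (y x : X) : Prop :=
  ∃ g : Arr X, g.cod = y ∧ g.dom = x

/-- `R` is treeable: there is a Borel graph `T ⊆ R` such that for almost every `x` the connected
component of `x` in `T` is a tree whose vertex set is the `R`-class of `x`. -/
def IsTreeable {X : Type u} [MeasurableSpace X] (μ : Measure X) (R : X → X → Prop) : Prop :=
  ∃ T : SimpleGraph X, MeasurableSet {p : X × X | T.Adj p.1 p.2} ∧
    (∀ y x, T.Adj y x → R y x) ∧
    ∀ᵐ x ∂μ, (T.connectedComponentMk x).toSimpleGraph.IsTree ∧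
      (T.connectedComponentMk x).supp = {y | R y x}

end Classes

end MeasuredGroupoid

/-! ### Analytic sets are universally measurable -/

section Analytic

open Set Filter Topology

/-! The two notions of unboundedness agree on every discrete measured groupoid.

If `b` is not strongly unbounded, each `δ` admits an `R` such that every element of the full group
has `R ≤ ‖b‖` only over ranges of measure at most `δ`. The set `S` of arrows with `R ≤ ‖b‖` is Borel
and closed under inversion, so up to a null set of units it is a countable union of bisections, each
containing with any arrow another one between the same ends in the opposite direction
(`exists_cover_isBisection`). Selecting greedily from these and adding units elsewhere gives a full
group element with arrows in `S` over exactly the ranges that matter, a Borel set `D` of measure at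
most `δ`. By maximality every arrow of `S` over the conull set has an end in `D`, so `‖b‖ < R`
between points off `D`. Letting `δ` tend to `0` exhausts `X`.

Conversely, a bounded `b` is bounded by some `M` on the arrows inside a single set `F` of almost
full measure (`Cocycle.IsBounded.exists_measure_compl_le`). An arrow of larger norm has its range or
its domain outside `F`. For the arrows of a full group element, invariance of `μ` bounds the measure
of such ranges by `2 μ Fᶜ`.

The cover by bisections rests on an almost everywhere Lusin-Novikov theorem. It removes isolated
points from the fibres as in a Cantor-Bendixson derivation, with minimality of measure in place of
transfinite recursion. The sets of base points that arise are coanalytic, hence the need for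
universal measurability. -/

theorem isCompact_setOf_forall_le (m : ℕ → ℕ) : IsCompact {y : ℕ → ℕ | ∀ i, y i ≤ m i} := by
  have : {y : ℕ → ℕ | ∀ i, y i ≤ m i} = Set.pi univ fun i => Set.Iic (m i) := by
    ext y; simp [Pi.le_def]
  rw [this]
  exact isCompact_univ_pi fun i => (Set.finite_Iic _).isCompact

/-- An open set containing `∏ i, [0, m i]` contains the cylinder `{y | ∀ i < k, y i ≤ m i}` for
some `k`. -/
theorem exists_bounded_cylinder_subset {m : ℕ → ℕ} {O : Set (ℕ → ℕ)} (hO : IsOpen O)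
    (hm : {y : ℕ → ℕ | ∀ i, y i ≤ m i} ⊆ O) : ∃ k, {y : ℕ → ℕ | ∀ i < k, y i ≤ m i} ⊆ O := by
  by_contra! h
  simp only [not_subset] at h
  choose y hy hyO using h
  have hK := isCompact_setOf_forall_le m
  -- Truncation at `m` puts the points in a compact set. It leaves coordinate `i` of `y k` unchanged
  -- for `k > i`, so the untruncated subsequence has the same limit.
  obtain ⟨a, ha, φ, hφ, hlim⟩ := hK.tendsto_subseq (x := fun k i => min (y k i) (m i))
    (fun k i => min_le_right _ _)
  have hlim' : Tendsto (fun n => y (φ n)) atTop (𝓝 a) := by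
    rw [tendsto_pi_nhds] at hlim ⊢
    intro i
    refine (hlim i).congr' ?_
    filter_upwards [eventually_gt_atTop i] with n hn
    exact min_eq_left (hy (φ n) i (hn.trans_le (hφ.id_le n)))
  exact hO.isClosed_compl.mem_of_tendsto hlim' (Eventually.of_forall fun n => hyO (φ n)) (hm ha)

/-- The measure of an analytic set is approximated by compact subsets. -/
theorem exists_isCompact_subset_range_lt_measure {X : Type*} [TopologicalSpace X] [MeasurableSpace X]
    (μ : Measure X) [μ.OuterRegular] {f : (ℕ → ℕ) → X} (hf : Continuous f) {c : ℝ≥0∞}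
    (hc : c < μ (range f)) : ∃ K ⊆ range f, IsCompact K ∧ c ≤ μ K := by
  have step : ∀ (S : Set (ℕ → ℕ)) (k : ℕ), c < μ (f '' S) →
      ∃ j, c < μ (f '' (S ∩ {y | y k ≤ j})) := by
    intro S k hS
    have hU : f '' S = ⋃ j, f '' (S ∩ {y | y k ≤ j}) := by
      rw [← image_iUnion, ← inter_iUnion]
      congr 1
      refine (inter_eq_left.2 fun y _ => mem_iUnion.2 ⟨y k, le_refl (y k)⟩).symm
    have hmono : Monotone fun j => f '' (S ∩ {y | y k ≤ j}) := fun i j hij =>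
      image_mono (inter_subset_inter_right _ fun y (hy : y k ≤ i) => hy.trans hij)
    -- Continuity from below holds for arbitrary sets, so the images need not be measurable here.
    rw [hU, hmono.measure_iUnion] at hS
    exact lt_iSup_iff.1 hS
  choose! j hj using step
  let S : ℕ → Set (ℕ → ℕ) := fun k => Nat.rec univ (fun k S => S ∩ {y | y k ≤ j S k}) k
  have hS : ∀ k, c < μ (f '' S k) := by
    intro k
    induction k with
    | zero => simpa [S] using hc
    | succ k ih => exact hj (S k) k ih
  let m : ℕ → ℕ := fun k => j (S k) k
  have hSm : ∀ k, S k = {y | ∀ i < k, y i ≤ m i} := by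
    intro k
    induction k with
    | zero => simp [S]
    | succ k ih =>
      change S k ∩ {y | y k ≤ m k} = _
      rw [ih]
      ext y
      simp only [mem_inter_iff, mem_ofPred_eq, Nat.lt_succ_iff_lt_or_eq]
      exact ⟨fun h i hi => hi.elim (h.1 i) (fun e => e ▸ h.2),
        fun h => ⟨fun i hi => h i (Or.inl hi), h k (Or.inr rfl)⟩⟩
  refine ⟨f '' {y | ∀ i, y i ≤ m i}, image_subset_range _ _, (isCompact_setOf_forall_le m).image hf, ?_⟩
  -- By outer regularity only open `U` containing the compact image matter. The preimage of such a
  -- `U` already contains some finite stage `S k`, whose image has measure above `c`.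
  rw [Set.measure_eq_iInf_isOpen]
  refine le_iInf₂ fun U hU => le_iInf fun hUo => ?_
  obtain ⟨k, hk⟩ := exists_bounded_cylinder_subset (hUo.preimage hf) (image_subset_iff.1 hU)
  rw [← hSm] at hk
  exact (hS k).le.trans (measure_mono (image_subset_iff.2 hk))

/-- Analytic sets are measurable for the completion of every finite Borel measure. -/
theorem MeasureTheory.AnalyticSet.nullMeasurableSet {X : Type*} [TopologicalSpace X] [PolishSpace X]
    [MeasurableSpace X] [BorelSpace X] {s : Set X} (hs : AnalyticSet s) (μ : Measure X)
    [IsFiniteMeasure μ] : NullMeasurableSet s μ := by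
  rw [AnalyticSet] at hs
  obtain rfl | ⟨f, hf, rfl⟩ := hs
  · exact nullMeasurableSet_empty
  let _ := TopologicalSpace.upgradeIsCompletelyMetrizable X
  by_cases h0 : μ (range f) = 0
  · exact NullMeasurableSet.of_null h0
  obtain ⟨c, -, hc, hlim⟩ := exists_seq_strictMono_tendsto' (pos_iff_ne_zero.2 h0)
  choose K hKf hK hKc using fun n => exists_isCompact_subset_range_lt_measure μ hf (hc n).2
  have hsub : (⋃ n, K n) ⊆ range f := iUnion_subset hKf
  have hm : MeasurableSet (⋃ n, K n) := .iUnion fun n => (hK n).measurableSet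
  have hle : μ (range f) ≤ μ (⋃ n, K n) :=
    le_of_tendsto' hlim fun n => (hKc n).trans (measure_mono (subset_iUnion K n))
  exact hm.nullMeasurableSet.congr
    (ae_eq_of_subset_of_measure_ge hsub hle hm.nullMeasurableSet (measure_ne_top _ _))

/-- The image of a Borel set under a Borel map between standard Borel spaces is measurable for the
completion of every finite measure. -/
theorem MeasurableSet.nullMeasurableSet_image {G X : Type*} [MeasurableSpace G]
    [StandardBorelSpace G] [MeasurableSpace X] [StandardBorelSpace X] {s : Set G}
    (hs : MeasurableSet s) {f : G → X} (hf : Measurable f) (μ : Measure X) [IsFiniteMeasure μ] :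
    NullMeasurableSet (f '' s) μ := by
  let _ := upgradeStandardBorel X
  exact (hs.analyticSet_image hf).nullMeasurableSet μ

end Analytic

/-! ### Countable-to-one Borel maps -/

section CountableToOne

open Set Filter Topology

/-- A nonempty countable closed subset of a Polish space has an isolated point. -/
theorem exists_isOpen_inter_eq_singleton {G : Type*} [TopologicalSpace G] [PolishSpace G]
    {C : Set G} (hC : IsClosed C) (hc : C.Countable) (hne : C.Nonempty) :
    ∃ g ∈ C, ∃ O : Set G, IsOpen O ∧ O ∩ C = {g} := by
  have : PolishSpace C := hC.polishSpace
  have : Countable C := hc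
  have : Nonempty C := hne.to_subtype
  let _ := TopologicalSpace.upgradeIsCompletelyMetrizable C
  -- Baire: a countable Polish space is a countable union of closed points, one of which has
  -- interior.
  obtain ⟨g, hg⟩ := nonempty_interior_of_iUnion_of_closed (f := fun g : C => ({g} : Set C))
    (fun g => isClosed_singleton) (by ext; simp)
  have hg' : IsOpen ({g} : Set C) := by
    rw [← interior_eq_iff_isOpen]
    exact (subset_singleton_iff_eq.1 interior_subset).resolve_left hg.ne_empty
  obtain ⟨O, hO, hOg⟩ := isOpen_induced_iff.1 hg'
  refine ⟨g, g.2, O, hO, ?_⟩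
  have := congrArg (Subtype.val '' ·) hOg
  simpa [Subtype.image_preimage_val, inter_comm] using this

/-- Borel sets `C` with relatively open fibres under `d` that are covered by countably many Borel
sets on which `d` is injective. -/
def IsOpenFibredCountableSection {G X : Type*} [TopologicalSpace G] [MeasurableSpace G] (d : G → X)
    (C : Set G) : Prop :=
  MeasurableSet C ∧ (∀ x, ∃ O : Set G, IsOpen O ∧ C ∩ d ⁻¹' {x} = O ∩ d ⁻¹' {x}) ∧
    ∃ V : ℕ → Set G, (∀ n, MeasurableSet (V n)) ∧ (∀ n, InjOn d (V n)) ∧ C ⊆ ⋃ n, V n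

theorem IsOpenFibredCountableSection.iUnion {G X : Type*} [TopologicalSpace G] [MeasurableSpace G]
    {d : G → X} {ι : Type*} [Countable ι] [Nonempty ι] {C : ι → Set G}
    (h : ∀ i, IsOpenFibredCountableSection d (C i)) :
    IsOpenFibredCountableSection d (⋃ i, C i) := by
  choose hm hO V hV hinj hcov using h
  refine ⟨.iUnion hm, fun x => ?_, ?_⟩
  · choose O hOo hOe using fun i => hO i x
    exact ⟨⋃ i, O i, isOpen_iUnion hOo, by simp only [iUnion_inter, hOe]⟩
  · obtain ⟨e, he⟩ := exists_surjective_nat (ι × ℕ)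
    refine ⟨fun n => V (e n).1 (e n).2, fun n => hV _ _, fun n => hinj _ _, ?_⟩
    refine iUnion_subset fun i => (hcov i).trans (iUnion_subset fun k => ?_)
    obtain ⟨n, hn⟩ := he (i, k)
    refine subset_iUnion_of_subset n ?_
    rw [hn]

/-- There is a set as in `IsOpenFibredCountableSection` whose complement has, in each member of a
given countable family of sets, a projection of minimal measure. -/
theorem exists_minimal_isOpenFibredCountableSection {G X : Type*} [TopologicalSpace G]
    [MeasurableSpace G] [MeasurableSpace X] (d : G → X) (μ : Measure X) (U : ℕ → Set G) :
    ∃ C, IsOpenFibredCountableSection d C ∧ ∀ C', IsOpenFibredCountableSection d C' →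
      ∀ n, μ (d '' (U n \ C)) ≤ μ (d '' (U n \ C')) := by
  have hempty : IsOpenFibredCountableSection d (∅ : Set G) :=
    ⟨.empty, fun x => ⟨∅, isOpen_empty, rfl⟩, fun _ => ∅, fun _ => .empty, fun _ => injOn_empty _,
      empty_subset _⟩
  have hne : ∀ n, ((fun C => μ (d '' (U n \ C))) '' {C | IsOpenFibredCountableSection d C}).Nonempty :=
    fun n => ⟨_, ∅, hempty, rfl⟩
  choose c _ hclim hc using fun n => exists_seq_tendsto_sInf (hne n) (OrderBot.bddBelow _)
  choose C hC hCc using hc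
  -- Enlarging `C` only shrinks the projections, so the union of minimizing sequences for all `n` is
  -- minimal for every `n` at once.
  refine ⟨⋃ p : ℕ × ℕ, C p.1 p.2, .iUnion fun p => hC p.1 p.2, fun C' hC' n => ?_⟩
  have h1 : μ (d '' (U n \ ⋃ p : ℕ × ℕ, C p.1 p.2)) ≤
      sInf ((fun C => μ (d '' (U n \ C))) '' {C | IsOpenFibredCountableSection d C}) := by
    refine ge_of_tendsto' (hclim n) fun k => ?_
    rw [← hCc n k]
    exact measure_mono (image_mono (sdiff_subset_sdiff_right
      (subset_iUnion (fun p : ℕ × ℕ => C p.1 p.2) (n, k))))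
  exact h1.trans (sInf_le ⟨C', hC', rfl⟩)

/-- Up to a null set, the **Lusin-Novikov theorem**: a countable-to-one Borel map between standard
Borel spaces is injective on each of countably many Borel sets covering its source. -/
theorem exists_cover_injOn_of_countable_fibre {G X : Type*} [MeasurableSpace G]
    [StandardBorelSpace G] [MeasurableSpace X] [StandardBorelSpace X] {d : G → X}
    (hd : Measurable d) (hcount : ∀ x, (d ⁻¹' {x}).Countable) (μ : Measure X) [IsFiniteMeasure μ] :
    ∃ (X₀ : Set X) (V : ℕ → Set G), MeasurableSet X₀ ∧ μ X₀ᶜ = 0 ∧ (∀ n, MeasurableSet (V n)) ∧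
      (∀ n, InjOn d (V n)) ∧ d ⁻¹' X₀ ⊆ ⋃ n, V n := by
  let _ := upgradeStandardBorel X
  let t₀ := upgradeStandardBorel G
  -- A finer Polish topology with the same Borel sets makes `d` continuous, hence its fibres closed.
  obtain ⟨t, ht, hdt, htp⟩ := hd.exists_continuous
  have hb : @BorelSpace G t _ :=
    @BorelSpace.mk G t _ ((t₀.toBorelSpace.measurable_eq).trans
      (borel_eq_borel_of_le htp t₀.toPolishSpace ht).symm)
  clear_value t₀
  clear ht t₀
  let _ := t
  obtain ⟨b, hbc, -, hbb⟩ := TopologicalSpace.exists_countable_basis G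
  have hbne : b.Nonempty ∨ IsEmpty G := by
    by_cases h : IsEmpty G
    · exact Or.inr h
    · obtain ⟨g⟩ := not_isEmpty_iff.1 h
      obtain ⟨u, hu, -⟩ := hbb.exists_subset_of_mem_open (mem_univ g) isOpen_univ
      exact Or.inl ⟨u, hu⟩
  obtain hbne | hG := hbne
  swap
  · exact ⟨univ, fun _ => ∅, .univ, by simp, fun _ => .empty, fun _ => injOn_empty _,
      fun g => (hG.false g).elim⟩
  obtain ⟨U, rfl⟩ := hbc.exists_eq_range hbne
  have hUo : ∀ n, IsOpen (U n) := fun n => hbb.isOpen (mem_range_self n)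
  have hUm : ∀ n, MeasurableSet (U n) := fun n => (hUo n).measurableSet
  obtain ⟨C, hC, hmin⟩ := exists_minimal_isOpenFibredCountableSection d μ U
  have hnull : ∀ n, NullMeasurableSet {x | (d ⁻¹' {x} ∩ (U n \ C)).Subsingleton} μ := by
    intro n
    -- Failure of uniqueness is the projection of a Borel set of pairs, hence analytic.
    have : {x | (d ⁻¹' {x} ∩ (U n \ C)).Subsingleton}ᶜ = (fun p : G × G => d p.1) ''
        (((U n \ C) ×ˢ (U n \ C)) ∩ {p | d p.1 = d p.2} ∩ {p | p.1 = p.2}ᶜ) := by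
      ext x
      simp only [Set.Subsingleton, mem_compl_iff, mem_ofPred_eq, not_forall, mem_image, Prod.exists]
      constructor
      · rintro ⟨g, hg, h, hh, hne⟩
        exact ⟨g, h, ⟨⟨⟨hg.2, hh.2⟩, hg.1.trans hh.1.symm⟩, hne⟩, hg.1⟩
      · rintro ⟨g, h, ⟨⟨⟨hg, hh⟩, he⟩, hne⟩, hx⟩
        exact ⟨g, ⟨hx, hg⟩, h, ⟨he.symm.trans hx, hh⟩, hne⟩
    have hm : MeasurableSet (((U n \ C) ×ˢ (U n \ C)) ∩ {p : G × G | d p.1 = d p.2} ∩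
        {p | p.1 = p.2}ᶜ) :=
      ((((hUm n).diff hC.1).prod ((hUm n).diff hC.1)).inter
        (measurableSet_eq_fun (hd.comp measurable_fst) (hd.comp measurable_snd))).inter
        (measurableSet_eq_fun measurable_fst measurable_snd).compl
    rw [← NullMeasurableSet.compl_iff, this]
    exact hm.nullMeasurableSet_image (hd.comp measurable_fst) μ
  choose M hMs hMm hMe using fun n => (hnull n).exists_measurable_subset_ae_eq
  have hMd : ∀ n, μ ({x | (d ⁻¹' {x} ∩ (U n \ C)).Subsingleton} \ M n) = 0 := fun n =>
    ae_le_set.1 (hMe n).symm.le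
  -- Over `M n` all of `U n` is added, which keeps the fibres relatively open. The new points lie in
  -- `U n \ C`, where `d` is injective over `M n`.
  have hC' : IsOpenFibredCountableSection d (C ∪ ⋃ n, (U n ∩ d ⁻¹' M n)) := by
    obtain ⟨hCm, hCo, V, hV, hVi, hVC⟩ := hC
    refine ⟨hCm.union (.iUnion fun n => (hUm n).inter (hd (hMm n))), fun x => ?_, ?_⟩
    · obtain ⟨O, hO, hOe⟩ := hCo x
      refine ⟨O ∪ ⋃ n, ⋃ (_ : x ∈ M n), U n,
        hO.union (isOpen_iUnion fun n => isOpen_iUnion fun _ => hUo n), ?_⟩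
      rw [union_inter_distrib_right, union_inter_distrib_right, hOe]
      congr 1
      ext g
      simp only [mem_inter_iff, mem_iUnion, mem_preimage, mem_singleton_iff, exists_prop]
      constructor
      · rintro ⟨⟨n, h1, h2⟩, rfl⟩
        exact ⟨⟨n, h2, h1⟩, rfl⟩
      · rintro ⟨⟨n, h1, h2⟩, rfl⟩
        exact ⟨⟨n, h2, h1⟩, rfl⟩
    · let V' : ℕ ⊕ ℕ → Set G := Sum.elim V fun n => (U n \ C) ∩ d ⁻¹' M n
      obtain ⟨e, he⟩ := exists_surjective_nat (ℕ ⊕ ℕ)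
      have hm : ∀ i, MeasurableSet (V' i) := by
        rintro (n | n)
        · exact hV n
        · exact ((hUm n).diff hCm).inter (hd (hMm n))
      have hi : ∀ i, InjOn d (V' i) := by
        rintro (n | n)
        · exact hVi n
        · rintro g ⟨hg, hgM⟩ h ⟨hh, -⟩ hgh
          exact hMs n hgM ⟨rfl, hg⟩ ⟨hgh.symm, hh⟩
      refine ⟨fun n => V' (e n), fun n => hm _, fun n => hi _, ?_⟩
      rw [he.iUnion_comp V']
      intro g hg
      by_cases hgC : g ∈ C
      · obtain ⟨n, hn⟩ := mem_iUnion.1 (hVC hgC)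
        exact mem_iUnion.2 ⟨Sum.inl n, hn⟩
      · obtain ⟨n, hn⟩ := mem_iUnion.1 (hg.resolve_left hgC)
        exact mem_iUnion.2 ⟨Sum.inr n, ⟨hn.1, hgC⟩, hn.2⟩
  -- The enlarged set no longer misses anything of `U n` over `M n`. By minimality of `C` this gain
  -- must be null.
  have hN : ∀ n, μ (d '' (U n \ C) ∩ M n) = 0 := by
    intro n
    have h1 := hmin _ hC' n
    have h2 : d '' (U n \ (C ∪ ⋃ n, (U n ∩ d ⁻¹' M n))) ⊆ d '' (U n \ C) \ M n := by
      rintro _ ⟨g, ⟨hgU, hg⟩, rfl⟩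
      simp only [mem_union, not_or] at hg
      exact ⟨⟨g, ⟨hgU, hg.1⟩, rfl⟩, fun h => hg.2 (mem_iUnion.2 ⟨n, hgU, h⟩)⟩
    have h3 := measure_inter_add_sdiff (μ := μ) (d '' (U n \ C)) (hMm n)
    have h4 := h1.trans (measure_mono h2)
    rw [← h3] at h4
    have h5 : μ (d '' (U n \ C) ∩ M n) + μ (d '' (U n \ C) \ M n) ≤
        0 + μ (d '' (U n \ C) \ M n) := by simpa using h4
    exact le_zero_iff.1 (ENNReal.le_of_add_le_add_right (measure_ne_top _ _) h5)
  let N : Set X := (⋃ n, d '' (U n \ C) ∩ M n) ∪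
    ⋃ n, ({x | (d ⁻¹' {x} ∩ (U n \ C)).Subsingleton} \ M n)
  have hN0 : μ N = 0 := measure_union_null (measure_iUnion_null hN) (measure_iUnion_null hMd)
  obtain ⟨-, hCo, V, hV, hVi, hVC⟩ := hC
  refine ⟨(toMeasurable μ N)ᶜ, V, (measurableSet_toMeasurable μ N).compl, ?_, hV, hVi, ?_⟩
  · rw [compl_compl, measure_toMeasurable, hN0]
  refine Subset.trans (fun g hg => ?_) hVC
  have hx : d g ∉ N := fun h => hg (subset_toMeasurable μ N h)
  by_contra hgC
  obtain ⟨O, hO, hOe⟩ := hCo (d g)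
  have hWe : d ⁻¹' {d g} \ C = d ⁻¹' {d g} \ O := by
    ext h
    have := Set.ext_iff.1 hOe h
    simp only [mem_inter_iff, Set.mem_sdiff] at this ⊢
    tauto
  -- What `C` misses of a fibre is closed and countable. If nonempty it has an isolated point, cut
  -- out by some basic set `U n`, which places the base point in `N`.
  have hW : IsClosed (d ⁻¹' {d g} \ C) := by
    rw [hWe]
    exact (isClosed_singleton.preimage hdt).sdiff hO
  obtain ⟨h, hh, O', hO', hOh⟩ := exists_isOpen_inter_eq_singleton hW
    ((hcount (d g)).mono sdiff_subset) ⟨g, rfl, hgC⟩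
  have hhO : h ∈ O' := (hOh.symm.subset rfl).1
  obtain ⟨_, ⟨n, rfl⟩, hhn, hnO⟩ := hbb.exists_subset_of_mem_open hhO hO'
  have hsub : (d ⁻¹' {d g} ∩ (U n \ C)).Subsingleton := by
    refine (subsingleton_singleton (a := h)).anti ?_
    rw [← hOh]
    rintro k ⟨hk, hkU, hkC⟩
    exact ⟨hnO hkU, hk, hkC⟩
  by_cases hM : d g ∈ M n
  · exact hx (Or.inl (mem_iUnion.2 ⟨n, ⟨h, ⟨hhn, hh.2⟩, hh.1⟩, hM⟩))
  · exact hx (Or.inr (mem_iUnion.2 ⟨n, hsub, hM⟩))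

end CountableToOne

namespace MeasuredGroupoid

open Set Filter Topology

/-! ### Involutive bisections and the full group -/

section FullGroup

variable {X : Type u} [Groupoid.{v} X]

/-- The inverse of an arrow. -/
def Arr.inv (g : Arr X) : Arr X := ⟨Groupoid.inv g.hom⟩

@[simp] theorem Arr.inv_inv (g : Arr X) : g.inv.inv = g := by
  cases g
  simp [Arr.inv, Groupoid.inv_eq_inv]

/-- The units met by the first `n` steps of the greedy selection of arrows with disjoint supports
from the bisections `τ 0, τ 1, …`. -/
def greedySupport (τ : ℕ → Set (Arr X)) : ℕ → Set X
  | 0 => ∅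
  | n + 1 => greedySupport τ n ∪
      (fun g : Arr X => g.dom) ''
        (τ n ∩ {g | g.dom ∉ greedySupport τ n ∧ g.cod ∉ greedySupport τ n})

/-- The arrows selected at step `n` of the greedy selection. -/
def greedyStep (τ : ℕ → Set (Arr X)) (n : ℕ) : Set (Arr X) :=
  τ n ∩ {g | g.dom ∉ greedySupport τ n ∧ g.cod ∉ greedySupport τ n}

theorem greedySupport_mono (τ : ℕ → Set (Arr X)) : Monotone (greedySupport τ) :=
  monotone_nat_of_le_succ fun _ => subset_union_left

variable [MeasurableSpace (Arr X)]

theorem IsBisection.eq_of_dom_eq {σ : Set (Arr X)} (hσ : IsBisection σ) {g h : Arr X} (hg : g ∈ σ)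
    (hh : h ∈ σ) (hgh : g.dom = h.dom) : g = h :=
  (hσ.2 h.dom).1 ⟨hg, hgh⟩ ⟨hh, rfl⟩

theorem IsBisection.eq_of_cod_eq {σ : Set (Arr X)} (hσ : IsBisection σ) {g h : Arr X} (hg : g ∈ σ)
    (hh : h ∈ σ) (hgh : g.cod = h.cod) : g = h :=
  (hσ.2 h.cod).2 ⟨hg, hgh⟩ ⟨hh, rfl⟩

variable [MeasurableSpace X]

/-- A Borel set of arrows, invariant under inversion, is covered up to a null set of units by
countably many bisections, each of which has for every arrow another one going backwards. -/
theorem exists_cover_isBisection (hG : DiscreteBorelGroupoid X) (μ : Measure X) [IsFiniteMeasure μ]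
    {S : Set (Arr X)} (hS : MeasurableSet S) (hSinv : ∀ g ∈ S, g.inv ∈ S) :
    ∃ (X₀ : Set X) (τ : ℕ → Set (Arr X)), MeasurableSet X₀ ∧ μ X₀ᶜ = 0 ∧
      (∀ n, IsBisection (τ n)) ∧ (∀ n, τ n ⊆ S) ∧
      (∀ n, ∀ g ∈ τ n, ∃ h ∈ τ n, h.dom = g.cod ∧ h.cod = g.dom) ∧
      ∀ g ∈ S, g.dom ∈ X₀ → g.cod ∈ X₀ → ∃ n, g ∈ τ n := by
  have := hG.standardBorel_units
  have := hG.standardBorel_arrows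
  have hinv : Measurable (Arr.inv : Arr X → Arr X) := hG.measurable_inv
  obtain ⟨X₀, V, hX₀, hX₀μ, hV, hVi, hVX⟩ :=
    exists_cover_injOn_of_countable_fibre hG.measurable_dom (fun x => hG.countable_fibre x) μ
  -- For a non-isotropy arrow a rational separates the images of its ends in `ℝ`. The domains of `J
  -- p` are then disjoint from its ranges, so `J p` together with its inverse is a bisection.
  obtain ⟨e, he⟩ := exists_measurableEmbedding_real X
  have hed : Measurable fun g : Arr X => e g.dom := he.measurable.comp hG.measurable_dom
  have hec : Measurable fun g : Arr X => e g.cod := he.measurable.comp hG.measurable_cod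
  let I : ℕ → Set (Arr X) := fun i => V i ∩ S ∩ {g | g.dom = g.cod}
  let J : ℕ × ℕ × ℚ → Set (Arr X) := fun p =>
    V p.1 ∩ Arr.inv ⁻¹' V p.2.1 ∩ S ∩ {g | e g.dom < p.2.2} ∩ {g | (p.2.2 : ℝ) < e g.cod}
  have hI : ∀ i, MeasurableSet (I i) := fun i => ((hV i).inter hS).inter
    (measurableSet_eq_fun hG.measurable_dom hG.measurable_cod)
  have hJ : ∀ p, MeasurableSet (J p) := fun p =>
    ((((hV _).inter (hinv (hV _))).inter hS).inter (measurableSet_lt hed measurable_const)).inter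
      (measurableSet_lt measurable_const hec)
  have hJd : ∀ p, ∀ g ∈ J p, ∀ h ∈ J p, g.dom = h.dom → g = h := fun p g hg h hh hgh =>
    hVi _ hg.1.1.1.1 hh.1.1.1.1 hgh
  have hJc : ∀ p, ∀ g ∈ J p, ∀ h ∈ J p, g.cod = h.cod → g = h := fun p g hg h hh hgh => by
    have := hVi _ hg.1.1.1.2 hh.1.1.1.2 (show g.inv.dom = h.inv.dom from hgh)
    rw [← g.inv_inv, this, h.inv_inv]
  have hJne : ∀ p, ∀ g ∈ J p, ∀ h ∈ J p, g.dom ≠ h.cod := fun p g hg h hh hgh => by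
    have h1 : e g.dom < (p.2.2 : ℝ) := hg.1.2
    have h2 : (p.2.2 : ℝ) < e h.cod := hh.2
    rw [hgh] at h1
    exact lt_asymm h1 h2
  let τ : ℕ ⊕ (ℕ × ℕ × ℚ) → Set (Arr X) := Sum.elim I fun p => J p ∪ Arr.inv ⁻¹' J p
  obtain ⟨s, hs⟩ := exists_surjective_nat (ℕ ⊕ (ℕ × ℕ × ℚ))
  have hτ : ∀ i, IsBisection (τ i) := by
    rintro (i | p)
    · refine ⟨hI i, fun x => ⟨?_, ?_⟩⟩
      · rintro g ⟨hg, rfl⟩ h ⟨hh, hgh⟩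
        exact hVi i hg.1.1 hh.1.1 (Eq.symm hgh)
      · rintro g ⟨hg, rfl⟩ h ⟨hh, hgh⟩
        exact hVi i hg.1.1 hh.1.1 (hg.2.trans ((Eq.symm hgh).trans hh.2.symm))
    · refine ⟨(hJ p).union (hinv (hJ p)), fun x => ⟨?_, ?_⟩⟩
      · rintro g ⟨hg | hg, rfl⟩ h ⟨hh | hh, hgh⟩
        · exact hJd p g hg h hh (Eq.symm hgh)
        · exact (hJne p g hg h.inv hh (Eq.symm hgh)).elim
        · exact (hJne p h hh g.inv hg hgh).elim
        · rw [← g.inv_inv, hJc p g.inv hg h.inv hh (Eq.symm hgh), h.inv_inv]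
      · rintro g ⟨hg | hg, rfl⟩ h ⟨hh | hh, hgh⟩
        · exact hJc p g hg h hh (Eq.symm hgh)
        · exact (hJne p h.inv hh g hg hgh).elim
        · exact (hJne p g.inv hg h hh (Eq.symm hgh)).elim
        · rw [← g.inv_inv, hJd p g.inv hg h.inv hh (Eq.symm hgh), h.inv_inv]
  have hτS : ∀ i, τ i ⊆ S := by
    rintro (i | p)
    · exact fun g hg => hg.1.2
    · rintro g (hg | hg)
      · exact hg.1.1.2
      · exact g.inv_inv ▸ hSinv _ hg.1.1.2
  have hτinv : ∀ i, ∀ g ∈ τ i, ∃ h ∈ τ i, h.dom = g.cod ∧ h.cod = g.dom := by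
    rintro (i | p) g hg
    -- An isotropy arrow serves as its own backward arrow, so `I i` need not be closed under
    -- inversion.
    · exact ⟨g, hg, hg.2, hg.2.symm⟩
    · refine ⟨g.inv, hg.symm.imp id fun h => ?_, rfl, rfl⟩
      rwa [mem_preimage, g.inv_inv]
  have hcov : ∀ g ∈ S, g.dom ∈ X₀ → g.cod ∈ X₀ → ∃ i, g ∈ τ i := by
    intro g hg hd hc
    obtain ⟨i, hi⟩ := mem_iUnion.1 (hVX hd)
    obtain ⟨j, hj⟩ := mem_iUnion.1 (hVX (show g.inv ∈ _ from hc))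
    by_cases hdc : g.dom = g.cod
    · exact ⟨Sum.inl i, ⟨hi, hg⟩, hdc⟩
    obtain hlt | hlt := lt_or_gt_of_ne (fun h => hdc (he.injective h))
    · obtain ⟨q, hq1, hq2⟩ := exists_rat_btwn hlt
      exact ⟨Sum.inr (i, j, q), Or.inl ⟨⟨⟨⟨hi, hj⟩, hg⟩, hq1⟩, hq2⟩⟩
    · obtain ⟨q, hq1, hq2⟩ := exists_rat_btwn hlt
      refine ⟨Sum.inr (j, i, q), Or.inr ⟨⟨⟨⟨hj, ?_⟩, hSinv g hg⟩, hq1⟩, hq2⟩⟩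
      rwa [mem_preimage, g.inv_inv]
  refine ⟨X₀, fun n => τ (s n), hX₀, hX₀μ, fun n => hτ _, fun n => hτS _, fun n => hτinv _,
    fun g hg hd hc => ?_⟩
  obtain ⟨i, hi⟩ := hcov g hg hd hc
  obtain ⟨n, rfl⟩ := hs i
  exact ⟨n, hi⟩

theorem measurableSet_greedyStep (hG : DiscreteBorelGroupoid X) {τ : ℕ → Set (Arr X)}
    (hτ : ∀ n, IsBisection (τ n)) {n : ℕ} (hn : MeasurableSet (greedySupport τ n)) :
    MeasurableSet (greedyStep τ n) :=
  (hτ n).1.inter ((hG.measurable_dom hn.compl).inter (hG.measurable_cod hn.compl))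

/-- The domain map is injective on a bisection, so Lusin-Souslin keeps each support Borel. -/
theorem measurableSet_greedySupport (hG : DiscreteBorelGroupoid X) {τ : ℕ → Set (Arr X)}
    (hτ : ∀ n, IsBisection (τ n)) (n : ℕ) : MeasurableSet (greedySupport τ n) := by
  have := hG.standardBorel_units
  have := hG.standardBorel_arrows
  induction n with
  | zero => exact .empty
  | succ n ih =>
    exact ih.union ((measurableSet_greedyStep hG hτ ih).image_of_measurable_injOn hG.measurable_dom
      fun g hg h hh hgh => (hτ n).eq_of_dom_eq hg.1 hh.1 hgh)

/-- From countably many bisections with backward arrows one obtains an element of the full group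
which, on a Borel set of units meeting every arrow of each bisection, consists of arrows from the
bisections. -/
theorem exists_isFullGroupElement_of_isBisection (hG : DiscreteBorelGroupoid X)
    {τ : ℕ → Set (Arr X)} (hτ : ∀ n, IsBisection (τ n))
    (hτinv : ∀ n, ∀ g ∈ τ n, ∃ h ∈ τ n, h.dom = g.cod ∧ h.cod = g.dom) :
    ∃ (σ : Set (Arr X)) (D : Set X), IsFullGroupElement σ ∧ MeasurableSet D ∧
      (∀ x ∈ D, ∃ g ∈ σ, g.cod = x ∧ ∃ n, g ∈ τ n) ∧
      ∀ n, ∀ g ∈ τ n, g.dom ∈ D ∨ g.cod ∈ D := by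
  have := hG.standardBorel_units
  have := hG.standardBorel_arrows
  let D : Set X := ⋃ n, greedySupport τ n
  let W : Set (Arr X) := ⋃ n, greedyStep τ n
  have hDm : MeasurableSet D := .iUnion (measurableSet_greedySupport hG hτ)
  have hWm : MeasurableSet W :=
    .iUnion fun n => measurableSet_greedyStep hG hτ (measurableSet_greedySupport hG hτ n)
  -- A backward arrow has the same two ends and so passes the same selection test. Hence the
  -- support, built from domains only, contains the ranges too.
  have hback : ∀ n, ∀ g ∈ greedyStep τ n, ∃ h ∈ greedyStep τ n, h.dom = g.cod ∧ h.cod = g.dom := by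
    intro n g hg
    obtain ⟨h, hh, h1, h2⟩ := hτinv n g hg.1
    exact ⟨h, ⟨hh, by rw [h1]; exact hg.2.2, by rw [h2]; exact hg.2.1⟩, h1, h2⟩
  have hdom : ∀ n, ∀ g ∈ greedyStep τ n, g.dom ∈ greedySupport τ (n + 1) := fun n g hg =>
    Or.inr ⟨g, hg, rfl⟩
  have hcod : ∀ n, ∀ g ∈ greedyStep τ n, g.cod ∈ greedySupport τ (n + 1) := fun n g hg => by
    obtain ⟨h, hh, h1, -⟩ := hback n g hg
    exact h1 ▸ hdom n h hh
  have hDdom : ∀ x ∈ D, ∃ g ∈ W, g.dom = x := by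
    intro x hx
    obtain ⟨n, hn⟩ := mem_iUnion.1 hx
    induction n with
    | zero => exact hn.elim
    | succ n ih =>
      obtain hn | ⟨g, hg, rfl⟩ := hn
      · exact ih hn
      · exact ⟨g, mem_iUnion.2 ⟨n, hg⟩, rfl⟩
  have hDcod : ∀ x ∈ D, ∃ g ∈ W, g.cod = x := by
    intro x hx
    obtain ⟨g, hg, rfl⟩ := hDdom x hx
    obtain ⟨n, hn⟩ := mem_iUnion.1 hg
    obtain ⟨h, hh, -, h2⟩ := hback n g hn
    exact ⟨h, mem_iUnion.2 ⟨n, hh⟩, h2⟩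
  have hWdom : ∀ g ∈ W, g.dom ∈ D := fun g hg => by
    obtain ⟨n, hn⟩ := mem_iUnion.1 hg
    exact mem_iUnion.2 ⟨n + 1, hdom n g hn⟩
  have hWcod : ∀ g ∈ W, g.cod ∈ D := fun g hg => by
    obtain ⟨n, hn⟩ := mem_iUnion.1 hg
    exact mem_iUnion.2 ⟨n + 1, hcod n g hn⟩
  have hWd : ∀ g ∈ W, ∀ h ∈ W, g.dom = h.dom → g = h := by
    intro g hg h hh hgh
    obtain ⟨n, hn⟩ := mem_iUnion.1 hg
    obtain ⟨m, hm⟩ := mem_iUnion.1 hh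
    obtain hlt | rfl | hlt := lt_trichotomy n m
    · exact (hm.2.1 (greedySupport_mono τ hlt (hgh ▸ hdom n g hn))).elim
    · exact (hτ n).eq_of_dom_eq hn.1 hm.1 hgh
    · exact (hn.2.1 (greedySupport_mono τ hlt (hgh ▸ hdom m h hm))).elim
  have hWc : ∀ g ∈ W, ∀ h ∈ W, g.cod = h.cod → g = h := by
    intro g hg h hh hgh
    obtain ⟨n, hn⟩ := mem_iUnion.1 hg
    obtain ⟨m, hm⟩ := mem_iUnion.1 hh
    obtain hlt | rfl | hlt := lt_trichotomy n m
    · exact (hm.2.2 (greedySupport_mono τ hlt (hgh ▸ hcod n g hn))).elim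
    · exact (hτ n).eq_of_cod_eq hn.1 hm.1 hgh
    · exact (hn.2.2 (greedySupport_mono τ hlt (hgh ▸ hcod m h hm))).elim
  -- Units over the complement of `D` complete the selection to an element of the full group.
  let U : Set (Arr X) := {g | (⟨𝟙 g.dom⟩ : Arr X) = g} ∩ {g | g.dom ∉ D}
  have hUm : MeasurableSet U :=
    (measurableSet_eq_fun (hG.measurable_unit.comp hG.measurable_dom) measurable_id).inter
      (hG.measurable_dom hDm.compl)
  have hUcod : ∀ g ∈ U, g.cod = g.dom := fun g hg => (congrArg Arr.cod hg.1).symm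
  have hUd : ∀ g ∈ U, ∀ h ∈ U, g.dom = h.dom → g = h := fun g hg h hh hgh => by
    rw [← hg.1, ← hh.1, hgh]
  refine ⟨W ∪ U, D, ⟨⟨hWm.union hUm, fun x => ⟨?_, ?_⟩⟩, fun x => ?_, fun x => ?_⟩, hDm, ?_, ?_⟩
  · rintro g ⟨hg | hg, rfl⟩ h ⟨hh | hh, hgh⟩
    · exact hWd g hg h hh (Eq.symm hgh)
    · exact (hh.2 ((show h.dom = g.dom from hgh) ▸ hWdom g hg)).elim
    · exact (hg.2 ((show h.dom = g.dom from hgh) ▸ hWdom h hh)).elim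
    · exact hUd g hg h hh (Eq.symm hgh)
  · rintro g ⟨hg | hg, rfl⟩ h ⟨hh | hh, hgh⟩
    · exact hWc g hg h hh (Eq.symm hgh)
    · exact (hh.2 ((hUcod h hh).symm.trans hgh ▸ hWcod g hg)).elim
    · exact (hg.2 ((hUcod g hg).symm.trans (Eq.symm hgh) ▸ hWcod h hh)).elim
    · exact hUd g hg h hh ((hUcod g hg).symm.trans ((Eq.symm hgh).trans (hUcod h hh)))
  · by_cases hx : x ∈ D
    · obtain ⟨g, hg, h⟩ := hDdom x hx
      exact ⟨g, Or.inl hg, h⟩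
    · exact ⟨⟨𝟙 x⟩, Or.inr ⟨rfl, hx⟩, rfl⟩
  · by_cases hx : x ∈ D
    · obtain ⟨g, hg, h⟩ := hDcod x hx
      exact ⟨g, Or.inl hg, h⟩
    · exact ⟨⟨𝟙 x⟩, Or.inr ⟨rfl, hx⟩, rfl⟩
  · intro x hx
    obtain ⟨g, hg, h⟩ := hDcod x hx
    obtain ⟨n, hn⟩ := mem_iUnion.1 hg
    exact ⟨g, Or.inl hg, h, n, hn.1⟩
  · intro n g hg
    by_contra! h
    -- An arrow of `τ n` with both ends off `D` would have been selected at step `n`.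
    have hgs : g ∈ greedyStep τ n :=
      ⟨hg, fun h' => h.1 (mem_iUnion.2 ⟨n, h'⟩), fun h' => h.2 (mem_iUnion.2 ⟨n, h'⟩)⟩
    exact h.1 (mem_iUnion.2 ⟨n + 1, hdom n g hgs⟩)

/-- If every element of the full group has arrows from the symmetric Borel set `S` over a set of
ranges of measure at most `δ`, then `S` contains no arrow with both ends in some Borel set whose
complement has measure at most `δ`. -/
theorem exists_measurableSet_avoiding_of_forall_isFullGroupElement (hG : DiscreteBorelGroupoid X)
    (μ : Measure X) [IsFiniteMeasure μ] {S : Set (Arr X)} (hS : MeasurableSet S)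
    (hSinv : ∀ g ∈ S, g.inv ∈ S) {δ : ℝ≥0∞}
    (hδ : ∀ σ, IsFullGroupElement σ → μ {x | ∃ g ∈ σ, g.cod = x ∧ g ∈ S} ≤ δ) :
    ∃ E, MeasurableSet E ∧ μ Eᶜ ≤ δ ∧ ∀ g ∈ S, g.dom ∈ E → g.cod ∉ E := by
  obtain ⟨X₀, τ, hX₀, hX₀μ, hτ, hτS, hτinv, hcov⟩ := exists_cover_isBisection hG μ hS hSinv
  obtain ⟨σ, D, hσ, hD, hDσ, hDτ⟩ := exists_isFullGroupElement_of_isBisection hG hτ hτinv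
  refine ⟨X₀ \ D, hX₀.diff hD, ?_, fun g hg hd hc => ?_⟩
  · have hsub : (X₀ \ D)ᶜ ⊆ X₀ᶜ ∪ {x | ∃ g ∈ σ, g.cod = x ∧ g ∈ S} := by
      intro x hx
      by_cases hx₀ : x ∈ X₀
      · obtain ⟨g, hg, hgx, n, hn⟩ := hDσ x (not_not.1 fun h => hx ⟨hx₀, h⟩)
        exact Or.inr ⟨g, hg, hgx, hτS n hn⟩
      · exact Or.inl hx₀
    calc μ (X₀ \ D)ᶜ ≤ μ X₀ᶜ + μ {x | ∃ g ∈ σ, g.cod = x ∧ g ∈ S} :=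
          (measure_mono hsub).trans (measure_union_le _ _)
      _ ≤ δ := by rw [hX₀μ, zero_add]; exact hδ σ hσ
  · obtain ⟨n, hn⟩ := hcov g hg hd.1 hc.1
    exact (hDτ n g hn).elim hd.2 hc.2

/-- An element of the full group has domain outside `F` only over a set of ranges of measure
`μ Fᶜ`. -/
theorem IsFullGroupElement.measure_setOf_exists_dom_notMem {μ : Measure X}
    (hG : IsDiscreteMeasuredGroupoid μ) {σ : Set (Arr X)} (hσ : IsFullGroupElement σ) {F : Set X}
    (hF : MeasurableSet F) : μ {x | ∃ g ∈ σ, g.cod = x ∧ g.dom ∉ F} = μ Fᶜ := by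
  have := hG.borel.standardBorel_units
  have := hG.borel.standardBorel_arrows
  have hA : MeasurableSet (σ ∩ {g : Arr X | g.dom ∉ F}) :=
    hσ.1.1.inter (hG.borel.measurable_dom hF.compl)
  -- Exactly one arrow of `σ` leaves and one enters each unit, so both masses are integrals of
  -- indicators.
  have hinv := hG.invariant _ hA
  have hd : domMass μ (σ ∩ {g : Arr X | g.dom ∉ F}) = μ Fᶜ := by
    rw [← lintegral_indicator_one hF.compl]
    refine lintegral_congr fun x => ?_
    by_cases hx : x ∈ F
    · have : {g : Arr X | g.dom = x} ∩ (σ ∩ {g : Arr X | g.dom ∉ F}) = ∅ := by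
        ext g
        simp only [mem_inter_iff, mem_ofPred_eq, mem_empty_iff_false, iff_false]
        rintro ⟨rfl, -, h⟩
        exact h hx
      simp [this, hx]
    · obtain ⟨g, hg, rfl⟩ := hσ.2.1 x
      have : {h : Arr X | h.dom = g.dom} ∩ (σ ∩ {g : Arr X | g.dom ∉ F}) = {g} := by
        ext h
        constructor
        · rintro ⟨h1, h2, -⟩
          exact hσ.1.eq_of_dom_eq h2 hg h1
        · rintro rfl
          exact ⟨rfl, hg, hx⟩
      simp [this, hx]
  have hR : {x | ∃ g ∈ σ, g.cod = x ∧ g.dom ∉ F} =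
      (fun g : Arr X => g.cod) '' (σ ∩ {g : Arr X | g.dom ∉ F}) := by
    ext x
    constructor
    · rintro ⟨g, h1, h2, h3⟩
      exact ⟨g, ⟨h1, h3⟩, h2⟩
    · rintro ⟨g, ⟨h1, h3⟩, h2⟩
      exact ⟨g, h1, h2, h3⟩
  have hRm : MeasurableSet {x | ∃ g ∈ σ, g.cod = x ∧ g.dom ∉ F} := by
    rw [hR]
    exact hA.image_of_measurable_injOn hG.borel.measurable_cod
      fun g hg h hh hgh => hσ.1.eq_of_cod_eq hg.1 hh.1 hgh
  have hc : codMass μ (σ ∩ {g : Arr X | g.dom ∉ F}) =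
      μ {x | ∃ g ∈ σ, g.cod = x ∧ g.dom ∉ F} := by
    rw [← lintegral_indicator_one hRm]
    refine lintegral_congr fun x => ?_
    by_cases hx : x ∈ {x | ∃ g ∈ σ, g.cod = x ∧ g.dom ∉ F}
    · obtain ⟨g, hg, rfl, hgF⟩ := id hx
      have : {h : Arr X | h.cod = g.cod} ∩ (σ ∩ {g : Arr X | g.dom ∉ F}) = {g} := by
        ext h
        constructor
        · rintro ⟨h1, h2, -⟩
          exact hσ.1.eq_of_cod_eq h2 hg h1
        · rintro rfl
          exact ⟨rfl, hg, hgF⟩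
      rw [this, indicator_of_mem hx]
      simp
    · have : {g : Arr X | g.cod = x} ∩ (σ ∩ {g : Arr X | g.dom ∉ F}) = ∅ := by
        ext g
        simp only [mem_inter_iff, mem_ofPred_eq, mem_empty_iff_false, iff_false]
        rintro ⟨h1, h2, h3⟩
        exact hx ⟨g, h2, h1, h3⟩
      rw [this, indicator_of_notMem hx]
      simp
  rw [← hc, ← hinv, hd]

end FullGroup

/-! ### The norm of a measurable field of vectors -/

section Norm

/-- The norm of a vector is determined by its inner products with countably many linear combinations
of a total sequence. -/
theorem norm_le_iff_forall_inner_le {𝕜 : Type*} [RCLike 𝕜] {H : Type*} [NormedAddCommGroup H]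
    [InnerProductSpace 𝕜 H] {f : ℕ → H}
    (hf : closure (Submodule.span 𝕜 (range f) : Set H) = univ) (v : H) (r : ℝ) :
    ‖v‖ ≤ r ↔ 0 ≤ r ∧ ∀ n k : ℕ,
      ‖inner 𝕜 (∑ i ∈ Finset.range n, TopologicalSpace.denseSeq (ℕ → 𝕜) k i • f i) v‖ ≤
        r * ‖∑ i ∈ Finset.range n, TopologicalSpace.denseSeq (ℕ → 𝕜) k i • f i‖ := by
  constructor
  · refine fun h => ⟨(norm_nonneg v).trans h, fun n k => ?_⟩
    rw [mul_comm]
    exact (norm_inner_le_norm _ _).trans (mul_le_mul_of_nonneg_left h (norm_nonneg _))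
  · rintro ⟨hr, h⟩
    -- The inequality passes from a dense set of coefficients to all of them, then to the closure of
    -- the span, and is finally applied to `d = v`.
    let T : Set H := {d | ‖inner 𝕜 d v‖ ≤ r * ‖d‖}
    have hT : IsClosed T := isClosed_le (by fun_prop) (by fun_prop)
    have hsum : ∀ (n : ℕ) (c : ℕ → 𝕜), ∑ i ∈ Finset.range n, c i • f i ∈ T := by
      intro n c
      have hcont : Continuous fun c : ℕ → 𝕜 => ∑ i ∈ Finset.range n, c i • f i := by fun_prop
      have hcl := (hT.preimage hcont).closure_subset_iff.2
        (range_subset_iff.2 fun k => show TopologicalSpace.denseSeq (ℕ → 𝕜) k ∈ _ from h n k)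
      rw [(TopologicalSpace.denseRange_denseSeq (ℕ → 𝕜)).closure_range] at hcl
      exact hcl (mem_univ c)
    have hspan : (Submodule.span 𝕜 (range f) : Set H) ⊆ T := by
      intro d hd
      obtain ⟨c, rfl⟩ := Finsupp.mem_span_range_iff_exists_finsupp.1 hd
      obtain ⟨n, hn⟩ := c.support.exists_nat_subset_range
      rw [Finsupp.sum_of_support_subset c hn _ (by simp)]
      exact hsum n c
    have hv : v ∈ T := hT.closure_subset_iff.2 hspan (hf ▸ mem_univ v)
    have hv' : ‖v‖ * ‖v‖ ≤ r * ‖v‖ := by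
      have hv : ‖inner 𝕜 v v‖ ≤ r * ‖v‖ := hv
      rwa [inner_self_eq_norm_sq_to_K, norm_pow, RCLike.norm_ofReal, abs_norm, sq] at hv
    -- The separate condition `0 ≤ r` is what settles `v = 0`; in a zero fibre the inequalities hold
    -- even for negative `r`.
    obtain h0 | h0 := (norm_nonneg v).eq_or_lt
    · exact h0 ▸ hr
    · exact le_of_mul_le_mul_right hv' h0

theorem HilbertBundle.IsMeasurableOver.measurable_norm {𝕜 : Type*} [RCLike 𝕜] {X : Type u}
    [MeasurableSpace X] {H : X → Type w} [∀ x, NormedAddCommGroup (H x)]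
    [∀ x, InnerProductSpace 𝕜 (H x)] {B : HilbertBundle 𝕜 H} {α : Type*} [MeasurableSpace α]
    {p : α → X} (hp : Measurable p) {v : ∀ a, H (p a)} (hv : B.IsMeasurableOver p v) :
    Measurable fun a => ‖v a‖ := by
  have hnorm : ∀ (n : ℕ) (c : ℕ → 𝕜),
      Measurable fun x => ‖∑ i ∈ Finset.range n, c i • B.frame i x‖ := by
    intro n c
    simp only [@norm_eq_sqrt_re_inner 𝕜, sum_inner, inner_sum, inner_smul_left, inner_smul_right]
    refine Real.continuous_sqrt.measurable.comp (RCLike.continuous_re.measurable.comp ?_)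
    exact Finset.measurable_fun_sum _ fun i _ => (Finset.measurable_fun_sum _ fun j _ =>
      (B.measurable_inner j i).const_mul _).const_mul _
  refine measurable_of_Iic fun r => ?_
  have : (fun a => ‖v a‖) ⁻¹' Iic r = ({_a | 0 ≤ r} : Set α) ∩ ⋂ n : ℕ, ⋂ k : ℕ, {a | ‖inner 𝕜
      (∑ i ∈ Finset.range n, TopologicalSpace.denseSeq (ℕ → 𝕜) k i • B.frame i (p a)) (v a)‖ ≤
        r * ‖∑ i ∈ Finset.range n, TopologicalSpace.denseSeq (ℕ → 𝕜) k i • B.frame i (p a)‖} := by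
    ext a
    simp only [mem_inter_iff, mem_iInter]
    exact norm_le_iff_forall_inner_le (B.total (p a)) (v a) r
  rw [this]
  refine (MeasurableSet.const _).inter (.iInter fun n => .iInter fun k => measurableSet_le ?_
    (((hnorm n _).comp hp).const_mul r))
  simp only [sum_inner, inner_smul_left]
  exact (Finset.measurable_fun_sum _ fun i _ => (hv i).const_mul _).norm

end Norm

/-! ### Bounded and strongly unbounded cocycles -/

section Cocycle

variable {X : Type u} [Groupoid.{v} X] [MeasurableSpace X] [MeasurableSpace (Arr X)]
  {μ : Measure X} {𝕜 : Type*} [RCLike 𝕜] {H : X → Type w} [∀ x, NormedAddCommGroup (H x)]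
  [∀ x, InnerProductSpace 𝕜 (H x)] {B : HilbertBundle 𝕜 H} {π : Representation μ B}

theorem Cocycle.map_id (b : Cocycle π) (x : X) : b.toFun (𝟙 x) = 0 := by
  have h := b.cocycle (𝟙 x) (𝟙 x)
  rw [Category.id_comp] at h
  simpa using h

theorem Cocycle.norm_inv (b : Cocycle π) (g : Arr X) :
    ‖b.toFun g.inv.hom‖ = ‖b.toFun g.hom‖ := by
  have h := b.cocycle g.hom (Groupoid.inv g.hom)
  rw [Groupoid.comp_inv, b.map_id] at h
  change ‖b.toFun (Groupoid.inv g.hom)‖ = _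
  rw [eq_neg_of_add_eq_zero_left h.symm, norm_neg, LinearIsometryEquiv.norm_map]

theorem Cocycle.norm_comp_le (b : Cocycle π) {x y z : X} (h : x ⟶ y) (g : y ⟶ z) :
    ‖b.toFun (h ≫ g)‖ ≤ ‖b.toFun g‖ + ‖b.toFun h‖ := by
  rw [b.cocycle, ← LinearIsometryEquiv.norm_map (π.toFun g) (b.toFun h)]
  exact norm_add_le _ _

theorem Cocycle.measurable_norm (hG : DiscreteBorelGroupoid X) (b : Cocycle π) :
    Measurable fun g : Arr X => ‖b.toFun g.hom‖ :=
  HilbertBundle.IsMeasurableOver.measurable_norm hG.measurable_cod b.measurable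

/-- A cocycle on a discrete measured groupoid which is not strongly unbounded is bounded. -/
theorem Cocycle.isBounded_of_not_isStronglyUnbounded (hG : IsDiscreteMeasuredGroupoid μ)
    (b : Cocycle π) (hb : ¬ b.IsStronglyUnbounded) : b.IsBounded := by
  have := hG.prob
  have hδ : ∀ n : ℕ, ∃ R : ℝ, ∀ σ : Set (Arr X), IsFullGroupElement σ →
      μ {x | ∃ g ∈ σ, g.cod = x ∧ R ≤ ‖b.toFun g.hom‖} ≤ ENNReal.ofReal (1 / (n + 1)) := by
    intro n
    by_contra! h
    refine hb ⟨1 / (n + 1), by positivity, fun R _ => h R⟩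
  choose R hR using hδ
  choose E hE hEμ hEb using fun n => exists_measurableSet_avoiding_of_forall_isFullGroupElement
    hG.borel μ (S := {g : Arr X | R n ≤ ‖b.toFun g.hom‖})
    (measurableSet_le measurable_const (b.measurable_norm hG.borel))
    (fun g hg => hg.trans (b.norm_inv g).ge) (hR n)
  refine ⟨E, hE, ?_, fun n => ⟨R n, ?_⟩⟩
  · rw [← prob_compl_eq_zero_iff (.iUnion hE), ← le_zero_iff]
    have hlim : Tendsto (fun n : ℕ => ENNReal.ofReal (1 / ((n : ℝ) + 1))) atTop (𝓝 0) := by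
      simpa using ENNReal.tendsto_ofReal (tendsto_one_div_add_atTop_nhds_zero_nat (𝕜 := ℝ))
    exact ge_of_tendsto' hlim fun n =>
      (measure_mono (compl_subset_compl.2 (subset_iUnion E n))).trans (hEμ n)
  · rintro _ ⟨g, hd, hc, rfl⟩
    by_contra! h
    exact hEb n g h.le hd hc

/-- A bounded cocycle is bounded on the arrows with both ends in a single set of almost full
measure. -/
theorem Cocycle.IsBounded.exists_measure_compl_le (hG : IsDiscreteMeasuredGroupoid μ)
    {b : Cocycle π} (hb : b.IsBounded) {ε : ℝ≥0∞} (hε : 0 < ε) :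
    ∃ (F : Set X) (M : ℝ), MeasurableSet F ∧ μ Fᶜ ≤ ε ∧
      ∀ g : Arr X, g.dom ∈ F → g.cod ∈ F → ‖b.toFun g.hom‖ ≤ M := by
  have := hG.prob
  have := hG.borel.standardBorel_units
  have := hG.borel.standardBorel_arrows
  obtain ⟨E, hE, hE1, hEb⟩ := hb
  choose C hC using hEb
  have hε2 : 0 < ε / 2 := ENNReal.half_pos hε.ne'
  have hUm : ∀ n, MeasurableSet (accumulate E n) := fun n =>
    .biUnion (to_countable _) fun i _ => hE i
  have hUlim : Tendsto (fun n => μ (accumulate E n)ᶜ) atTop (𝓝 0) := by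
    have h := tendsto_measure_iInter_atTop (μ := μ) (s := fun n => (accumulate E n)ᶜ)
      (fun n => (hUm n).compl.nullMeasurableSet)
      (fun m n hmn => compl_subset_compl.2 (monotone_accumulate hmn)) ⟨0, measure_ne_top _ _⟩
    rwa [← compl_iUnion, iUnion_accumulate, (prob_compl_eq_zero_iff (.iUnion hE)).2 hE1] at h
  obtain ⟨n, hn⟩ := (hUlim.eventually_le_const hε2).exists
  -- The hypothesis says nothing about arrows between different `E i` and `E j`. The units `Z M`
  -- from which an arrow of norm above `M` enters the first `n + 1` sets are therefore discarded.
  let A : ℕ → Set (Arr X) := fun M => {g | g.cod ∈ accumulate E n} ∩ {g | M < ‖b.toFun g.hom‖}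
  have hA : ∀ M, MeasurableSet (A M) := fun M => (hG.borel.measurable_cod (hUm n)).inter
    (measurableSet_lt measurable_const (b.measurable_norm hG.borel))
  let Z : ℕ → Set X := fun M => (fun g : Arr X => g.dom) '' A M
  have hZ : Antitone Z := fun M M' hM => image_mono fun g hg =>
    ⟨hg.1, (Nat.cast_le.2 hM).trans_lt (show (M' : ℝ) < ‖b.toFun g.hom‖ from hg.2)⟩
  have hZe : ⋂ M, Z M = ∅ := by
    refine eq_empty_of_forall_notMem fun x hx => ?_
    have hj : ∀ j, ∃ K : ℝ, ∀ g : Arr X, g.dom = x → g.cod ∈ E j → ‖b.toFun g.hom‖ ≤ K := by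
      intro j
      by_cases h : ∃ h : Arr X, h.dom = x ∧ h.cod ∈ E j
      · obtain ⟨h, rfl, hc⟩ := h
        -- Any two arrows from `x` into `E j` differ by an arrow inside `E j`, on which `b` is
        -- bounded by `C j`.
        refine ⟨C j + ‖b.toFun h.hom‖, ?_⟩
        rintro ⟨g⟩ (rfl : _ = h.dom) hgc
        have h1 := b.norm_comp_le h.hom (Groupoid.inv h.hom ≫ g)
        rw [← Category.assoc, Groupoid.comp_inv, Category.id_comp] at h1
        exact h1.trans (add_le_add_left (hC j ⟨⟨Groupoid.inv h.hom ≫ g⟩, hc, hgc, rfl⟩) _)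
      · push Not at h
        exact ⟨0, fun g hg hc => (h g hg hc).elim⟩
    choose K hK using hj
    obtain ⟨M, hM⟩ := exists_nat_ge (∑ j ∈ Finset.range (n + 1), |K j|)
    obtain ⟨g, ⟨hgc, hgM⟩, hgx⟩ := mem_iInter.1 hx M
    obtain ⟨j, hjn, hj⟩ := mem_accumulate.1 hgc
    have h1 : |K j| ≤ ∑ j ∈ Finset.range (n + 1), |K j| :=
      Finset.single_le_sum (fun i _ => abs_nonneg (K i)) (Finset.mem_range.2 (Nat.lt_succ_of_le hjn))
    have h2 : ‖b.toFun g.hom‖ ≤ K j := hK j g hgx hj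
    exact absurd hgM (not_lt.2 (h2.trans ((le_abs_self _).trans (h1.trans hM))))
  have hZlim : Tendsto (fun M => μ (Z M)) atTop (𝓝 0) := by
    have h := tendsto_measure_iInter_atTop (μ := μ) (s := Z)
      (fun M => (hA M).nullMeasurableSet_image hG.borel.measurable_dom μ) hZ
      ⟨0, measure_ne_top _ _⟩
    rwa [hZe, measure_empty] at h
  obtain ⟨M, hM⟩ := (hZlim.eventually_le_const hε2).exists
  refine ⟨accumulate E n \ toMeasurable μ (Z M), M, (hUm n).diff (measurableSet_toMeasurable _ _),
    ?_, fun g hd hc => ?_⟩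
  · calc μ (accumulate E n \ toMeasurable μ (Z M))ᶜ
        ≤ μ ((accumulate E n)ᶜ ∪ toMeasurable μ (Z M)) := measure_mono fun x hx => by
          by_cases h : x ∈ accumulate E n
          · exact Or.inr (not_not.1 fun h' => hx ⟨h, h'⟩)
          · exact Or.inl h
      _ ≤ μ (accumulate E n)ᶜ + μ (toMeasurable μ (Z M)) := measure_union_le _ _
      _ ≤ ε / 2 + ε / 2 := add_le_add hn (by rwa [measure_toMeasurable])
      _ = ε := ENNReal.add_halves ε
  · by_contra! h
    exact hd.2 (subset_toMeasurable μ _ ⟨g, ⟨hc.1, h⟩, rfl⟩)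

/-- Invariance gives domains outside `F` the same weight as ranges outside `F`, so each is allotted
`δ / 2`. -/
theorem Cocycle.IsStronglyUnbounded.isUnbounded (hG : IsDiscreteMeasuredGroupoid μ)
    {b : Cocycle π} (hb : b.IsStronglyUnbounded) : b.IsUnbounded := by
  intro hbb
  obtain ⟨δ, hδ, hb⟩ := hb
  obtain ⟨F, M, hF, hFμ, hFM⟩ := hbb.exists_measure_compl_le hG
    (ENNReal.half_pos (ENNReal.ofReal_pos.2 hδ).ne')
  -- `|M| + 1` is positive and exceeds `M`, whatever the sign of `M`.
  obtain ⟨σ, hσ, hlt⟩ := hb (|M| + 1) (by positivity)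
  refine hlt.not_ge ?_
  calc μ {x | ∃ g ∈ σ, g.cod = x ∧ |M| + 1 ≤ ‖b.toFun g.hom‖}
      ≤ μ (Fᶜ ∪ {x | ∃ g ∈ σ, g.cod = x ∧ g.dom ∉ F}) := by
        refine measure_mono ?_
        rintro _ ⟨g, hg, rfl, hgM⟩
        by_contra! h
        simp only [mem_union, mem_compl_iff, mem_ofPred_eq, not_or, not_not, not_exists,
          not_and] at h
        have := hFM g (h.2 g hg rfl) h.1
        linarith [le_abs_self M]
    _ ≤ μ Fᶜ + μ {x | ∃ g ∈ σ, g.cod = x ∧ g.dom ∉ F} := measure_union_le _ _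
    _ ≤ ENNReal.ofReal δ / 2 + ENNReal.ofReal δ / 2 := by
        rw [hσ.measure_setOf_exists_dom_notMem hG hF]
        exact add_le_add hFμ hFμ
    _ = ENNReal.ofReal δ := ENNReal.add_halves _

/-- On an arbitrary discrete measured groupoid, a cocycle is unbounded if and only if it is strongly
unbounded. -/
theorem Cocycle.isUnbounded_iff_isStronglyUnbounded (hG : IsDiscreteMeasuredGroupoid μ)
    (b : Cocycle π) : b.IsUnbounded ↔ b.IsStronglyUnbounded :=
  ⟨fun h => by_contra fun hs => h (b.isBounded_of_not_isStronglyUnbounded hG hs),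
    fun h => h.isUnbounded hG⟩

end Cocycle

end MeasuredGroupoid

/-- All four assertions hold because unboundedness and strong unboundedness agree on every discrete
measured groupoid: given `R`, a maximal family of arrows `g` with `R ≤ ‖b(g)‖` and pairwise disjoint
supports extends to an element of the full group. -/
theorem mainTheorem9
    {X : Type u} [Groupoid.{v} X] [MeasurableSpace X] [MeasurableSpace (MeasuredGroupoid.Arr X)]
    (μ : Measure X) (hG : MeasuredGroupoid.IsDiscreteMeasuredGroupoid μ)
    {𝕜 : Type*} [RCLike 𝕜] {H : X → Type w} [∀ x, NormedAddCommGroup (H x)]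
    [∀ x, InnerProductSpace 𝕜 (H x)] [∀ x, CompleteSpace (H x)]
    (B : MeasuredGroupoid.HilbertBundle 𝕜 H) (π : MeasuredGroupoid.Representation μ B)
    (b : MeasuredGroupoid.Cocycle π) :
    (b.IsStronglyUnbounded → b.IsUnbounded) ∧
    (MeasuredGroupoid.IsSemidirectProduct μ → (b.IsUnbounded ↔ b.IsStronglyUnbounded)) ∧
    (MeasuredGroupoid.IsGroupBundle X → (b.IsUnbounded ↔ b.IsStronglyUnbounded)) ∧
    (MeasuredGroupoid.IsTreeable μ (MeasuredGroupoid.orbitRel X) →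
      (b.IsUnbounded ↔ b.IsStronglyUnbounded)) :=
  ⟨fun h => h.isUnbounded hG, fun _ => b.isUnbounded_iff_isStronglyUnbounded hG,
    fun _ => b.isUnbounded_iff_isStronglyUnbounded hG,
    fun _ => b.isUnbounded_iff_isStronglyUnbounded hG⟩
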